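/- Let $n\ge 1$ and let $L_0,L_1,L_2,M\in\mathbb R^{n\times n}$, where $L_0$ and $L_2$ are symmetric, $L_1$ is skew-symmetric, $M$ is symmetric positive definite, and $L_2$ is nonsingular. Define the $2n\times 2n$ matrices $$\widetilde L_2=\begin{bmatrix}L_2&0\\0&L_2\end{bmatrix},\quad \widetilde L_1=\begin{bmatrix}L_1&0\\2L_2&L_1\end{bmatrix},\quad \widetilde L_0=\begin{bmatrix}L_0&0\\L_1&L_0\end{bmatrix},\quad \widetilde M=\begin{bmatrix}M&0\\0&M\end{bmatrix}$$ and the $2\times 2$ matrices $$C_2=\begin{bmatrix}1&0\\0&0\end{bmatrix},\quad C_1=\begin{bmatrix}0&-1\\-1&0\end{bmatrix},\quad C_0=\begin{bmatrix}0&0\\0&1\end{bmatrix},$$ and the $4n^2\times 4n^2$ matrices $$\Delta_0=\begin{vmatrix}L_2&L_1&M\\ \widetilde L_2&\widetilde L_1&\widetilde M\\ C_2&C_1&0\end{vmatrix}_\otimes,\qquad \Delta_1=-\begin{vmatrix}L_2&L_0&M\\ \widetilde L_2&\widetilde L_0&\widetilde M\\ C_2&C_0&0\end{vmatrix}_\otimes,$$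 where $|\cdot|_\otimes$ denotes the Leibniz expansion of the $3\times3$ determinant in which the products of the entries (taken in the order of the rows) are Kronecker products. Let $k,\omega\in\mathbb C$, and suppose that there are vectors $u,u'\in\mathbb C^n$ with $u\neq 0$ such that $$\bigl[(\mathrm ik)^2L_2+\mathrm ik\,L_1+L_0+\omega^2M\bigr]u=0\quad\text{and}\quad \bigl[(\mathrm ik)^2\widetilde L_2+\mathrm ik\,\widetilde L_1+\widetilde L_0+\omega^2\widetilde M\bigr]\begin{bmatrix}u\\u'\end{bmatrix}=0 .$$ Then the pencil $\Delta_1-\xi\Delta_0$ is singular, i.e. $\det(\Delta_1-\xi\Delta_0)=0$ for all $\xi\in\mathbb C$, and $\lambda=\mathrm ik$ is a finite eigenvalue of it, i.e. $$\operatorname{rank}(\Delta_1-\mathrm ik\,\Delta_0)<\max_{\xi\in\mathbb C}\operatorname{rank}(\Delta_1-\xi\Delta_0).$$ -/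

import Mathlib

open scoped Kronecker

namespace ZGV

/-- The entrywise complexification of a real matrix. -/
noncomputable def cx {m : Type*} (A : Matrix m m ℝ) : Matrix m m ℂ :=
  A.map (fun x : ℝ => (x : ℂ))

/-- The discrete waveguide operator
`W(k, ω) = (i k)² L₂ + (i k) L₁ + L₀ + ω² M`. -/
noncomputable def waveguideOp {n : ℕ} (L₀ L₁ L₂ M : Matrix (Fin n) (Fin n) ℝ) (k ω : ℂ) :
    Matrix (Fin n) (Fin n) ℂ :=
  (Complex.I * k) ^ 2 • cx L₂ + (Complex.I * k) • cx L₁ + cx L₀ + ω ^ 2 • cx M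

/-- `L̃₂ = [L₂, 0; 0, L₂]`. -/
def tildeL₂ {n : ℕ} (L₂ : Matrix (Fin n) (Fin n) ℝ) :
    Matrix (Fin n ⊕ Fin n) (Fin n ⊕ Fin n) ℝ :=
  Matrix.fromBlocks L₂ 0 0 L₂

/-- `L̃₁ = [L₁, 0; 2 L₂, L₁]`. -/
def tildeL₁ {n : ℕ} (L₁ L₂ : Matrix (Fin n) (Fin n) ℝ) :
    Matrix (Fin n ⊕ Fin n) (Fin n ⊕ Fin n) ℝ :=
  Matrix.fromBlocks L₁ 0 ((2 : ℝ) • L₂) L₁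

/-- `L̃₀ = [L₀, 0; L₁, L₀]`. -/
def tildeL₀ {n : ℕ} (L₀ L₁ : Matrix (Fin n) (Fin n) ℝ) :
    Matrix (Fin n ⊕ Fin n) (Fin n ⊕ Fin n) ℝ :=
  Matrix.fromBlocks L₀ 0 L₁ L₀

/-- `M̃ = [M, 0; 0, M]`. -/
def tildeM {n : ℕ} (M : Matrix (Fin n) (Fin n) ℝ) :
    Matrix (Fin n ⊕ Fin n) (Fin n ⊕ Fin n) ℝ :=
  Matrix.fromBlocks M 0 0 M

/-- The `2n × 2n` matrix of the exceptional mode equation,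
`(i k)² L̃₂ + (i k) L̃₁ + L̃₀ + ω² M̃`. -/
noncomputable def exceptionalOp {n : ℕ} (L₀ L₁ L₂ M : Matrix (Fin n) (Fin n) ℝ) (k ω : ℂ) :
    Matrix (Fin n ⊕ Fin n) (Fin n ⊕ Fin n) ℂ :=
  (Complex.I * k) ^ 2 • cx (tildeL₂ L₂) + (Complex.I * k) • cx (tildeL₁ L₁ L₂)
    + cx (tildeL₀ L₀ L₁) + ω ^ 2 • cx (tildeM M)

/-- `(i k, ω)` solves the waveguide problem and the exceptional mode equation: there are a nonzero
vector `u` with `W(k, ω) u = 0` and a vector `u'` such that `ũ = [u; u']` is annihilated by the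
`2n × 2n` matrix of the exceptional mode equation. -/
def IsZGVSolution {n : ℕ} (L₀ L₁ L₂ M : Matrix (Fin n) (Fin n) ℝ) (k ω : ℂ) : Prop :=
  ∃ u u' : Fin n → ℂ, u ≠ 0 ∧
    (waveguideOp L₀ L₁ L₂ M k ω).mulVec u = 0 ∧
    (exceptionalOp L₀ L₁ L₂ M k ω).mulVec (Sum.elim u u') = 0

/-- `C₂ = [1, 0; 0, 0]`. -/
def C₂ : Matrix (Fin 2) (Fin 2) ℝ := !![1, 0; 0, 0]

/-- `C₁ = [0, -1; -1, 0]`. -/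
def C₁ : Matrix (Fin 2) (Fin 2) ℝ := !![0, -1; -1, 0]

/-- `C₀ = [0, 0; 0, 1]`. -/
def C₀ : Matrix (Fin 2) (Fin 2) ℝ := !![0, 0; 0, 1]

/-- The operator determinant of a `3 × 3` array of square matrices, whose three rows consist of
matrices of sizes `p`, `q`, `r`: the Leibniz expansion of the determinant with Kronecker products,
taken in the order of the rows, in place of products. -/
def opDet {p q r : Type*}
    (A₁ A₂ A₃ : Matrix p p ℝ) (B₁ B₂ B₃ : Matrix q q ℝ) (D₁ D₂ D₃ : Matrix r r ℝ) :
    Matrix (p × q × r) (p × q × r) ℝ :=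
  A₁ ⊗ₖ (B₂ ⊗ₖ D₃) + A₂ ⊗ₖ (B₃ ⊗ₖ D₁) + A₃ ⊗ₖ (B₁ ⊗ₖ D₂)
    - A₃ ⊗ₖ (B₂ ⊗ₖ D₁) - A₂ ⊗ₖ (B₁ ⊗ₖ D₃) - A₁ ⊗ₖ (B₃ ⊗ₖ D₂)

/-- `Δ₀ = |L₂, L₁, M; L̃₂, L̃₁, M̃; C₂, C₁, 0|_⊗`, of size `n · 2n · 2 = 4n²`. -/
def Δ₀ {n : ℕ} (L₁ L₂ M : Matrix (Fin n) (Fin n) ℝ) :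
    Matrix (Fin n × (Fin n ⊕ Fin n) × Fin 2) (Fin n × (Fin n ⊕ Fin n) × Fin 2) ℝ :=
  opDet L₂ L₁ M
    (tildeL₂ L₂) (tildeL₁ L₁ L₂) (tildeM M)
    C₂ C₁ 0

/-- `Δ₁ = - |L₂, L₀, M; L̃₂, L̃₀, M̃; C₂, C₀, 0|_⊗`, of size `n · 2n · 2 = 4n²`. -/
def Δ₁ {n : ℕ} (L₀ L₁ L₂ M : Matrix (Fin n) (Fin n) ℝ) :
    Matrix (Fin n × (Fin n ⊕ Fin n) × Fin 2) (Fin n × (Fin n ⊕ Fin n) × Fin 2) ℝ :=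
  -opDet L₂ L₀ M
    (tildeL₂ L₂) (tildeL₀ L₀ L₁) (tildeM M)
    C₂ C₀ 0

/-- The normal rank of the pencil `A - ξ B`: the largest rank of `A - ξ B` over `ξ ∈ ℂ`. -/
noncomputable def normalRank {m : Type*} [Fintype m] (A B : Matrix m m ℂ) : ℕ :=
  ⨆ ξ : ℂ, (A - ξ • B).rank

/-- The supremum in `normalRank` is a maximum. -/
theorem isGreatest_normalRank {m : Type*} [Fintype m] (A B : Matrix m m ℂ) :
    IsGreatest (Set.range fun ξ : ℂ => (A - ξ • B).rank) (normalRank A B) := by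
  have hb : BddAbove (Set.range fun ξ : ℂ => (A - ξ • B).rank) :=
    ⟨Fintype.card m, by rintro _ ⟨ξ, rfl⟩; exact Matrix.rank_le_card_width _⟩
  exact ⟨Nat.sSup_mem (Set.range_nonempty _) hb, fun _ hx => le_csSup hb hx⟩

/-- The pencil `A - ξ B` is singular: `det (A - ξ B)` vanishes for every `ξ ∈ ℂ`. -/
def IsSingularPencil {m : Type*} [Fintype m] [DecidableEq m] (A B : Matrix m m ℂ) : Prop :=
  ∀ ξ : ℂ, (A - ξ • B).det = 0

/-- `l` is a finite eigenvalue of the pencil `A - ξ B`: the rank drops below the normal rank. -/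
def IsFiniteEigenvalue {m : Type*} [Fintype m] (A B : Matrix m m ℂ) (l : ℂ) : Prop :=
  (A - l • B).rank < normalRank A B

end ZGV

/-!
Put `Q(x) = x² L₂ + x L₁ + L₀`. Along the `2 × 2` factor, the pencil `Δ₁ - x Δ₀` is a symmetric
linearization of a matrix polynomial quadratic in `x`, so up to invertible factors it is
`diag(T(x), T₂)`, where `T(x)` is the operator determinant of the rows `Q(x), M` and
`[Q(x), 0; Q'(x), Q(x)], M̃`, and `T₂` is the one of `L₂, M` and `L̃₂, M̃`. The matrix `T₂` is block
triangular with diagonal blocks `L₂ ⊗ M - M ⊗ L₂`, which annihilate `vec M⁻¹`; this makes the pencil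
singular.

The matrix `T(x)` is block triangular with both diagonal blocks equal to
`S(x) = Q(x) ⊗ M - M ⊗ Q(x)`, so `rank T(x) ≤ n² + rank S(x)`, with equality if and only if `Y = 0`
for every solution `(Y, Z)` of `M Y Qᵀ = Q Y M` and `Q' Y M = M Z Qᵀ - Q Z M`. At a ZGV solution,
`Y = u uᵀ` and `Z = u' uᵀ` violate this. For `x` on the imaginary axis, after a congruence that
turns `M` into the identity, `Q` is Hermitian; then `Q' Y = Z Qᵀ - Q Z` is Frobenius-orthogonal
to `Q Y = Y Qᵀ`, and for large `|x|` this forces `Y = 0`. Since `rank S(x)` is also maximal outside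
a finite set, the rank at `x = i k` is below that at a far imaginary point.
-/

namespace ZGV

open Matrix Polynomial Filter Topology

theorem sumElim_eq_zero_iff {α β M : Type*} [Zero M] {y : α → M} {z : β → M} :
    Sum.elim y z = 0 ↔ y = 0 ∧ z = 0 := by
  rw [← Sum.elim_zero_zero, Sum.elim_eq_iff]

section Rank

variable {K : Type*} [Field K]

theorem finrank_submodule_prod {V W : Type*} [AddCommGroup V] [Module K V] [AddCommGroup W]
    [Module K W] (p : Submodule K V) (q : Submodule K W) [FiniteDimensional K p]
    [FiniteDimensional K q] :
    Module.finrank K (p.prod q) = Module.finrank K p + Module.finrank K q := by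
  have hrange : LinearMap.range (p.subtype.prodMap q.subtype) = p.prod q := by
    rw [LinearMap.range_prodMap, p.range_subtype, q.range_subtype]
  rw [← hrange, LinearMap.finrank_range_of_inj
    (p.injective_subtype.prodMap q.injective_subtype), Module.finrank_prod]

theorem rank_fromBlocks_zero_zero {m₁ n₁ m₂ n₂ : Type*} [Finite m₁] [Fintype n₁] [Finite m₂]
    [Fintype n₂] (A : Matrix m₁ n₁ K) (D : Matrix m₂ n₂ K) :
    (fromBlocks A 0 0 D).rank = A.rank + D.rank := by
  let e := LinearEquiv.sumArrowLequivProdArrow n₁ n₂ K K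
  let e' := LinearEquiv.sumArrowLequivProdArrow m₁ m₂ K K
  have hfactor : (fromBlocks A 0 0 D).mulVecLin =
      e'.symm ∘ₗ A.mulVecLin.prodMap D.mulVecLin ∘ₗ e := by
    refine LinearMap.ext fun v => ?_
    ext i
    cases i <;> simp [e, e', mulVec, dotProduct]
  rw [rank, hfactor, LinearMap.range_comp, LinearEquiv.finrank_map_eq,
    LinearMap.range_comp_of_range_eq_top _ e.range, LinearMap.range_prodMap,
    finrank_submodule_prod, rank, rank]

theorem rank_add_finrank_ker {m n : Type*} [Fintype n] (A : Matrix m n K) :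
    A.rank + Module.finrank K (LinearMap.ker A.mulVecLin) = Fintype.card n := by
  rw [rank, LinearMap.finrank_range_add_finrank_ker, Module.finrank_fintype_fun_eq_card]

theorem rank_mul_eq_right_iff {l m n : Type*} [Fintype m] [Fintype n] (B : Matrix l m K)
    (A : Matrix m n K) : (B * A).rank = A.rank ↔ ∀ v, (B * A) *ᵥ v = 0 → A *ᵥ v = 0 := by
  have hle : LinearMap.ker A.mulVecLin ≤ LinearMap.ker (B * A).mulVecLin := by
    rw [mulVecLin_mul]
    exact LinearMap.ker_le_ker_comp _ _
  have hA := rank_add_finrank_ker A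
  have hBA := rank_add_finrank_ker (B * A)
  constructor
  · intro h v hv
    have hker := Submodule.eq_of_le_of_finrank_eq hle (by omega)
    exact (SetLike.ext_iff.mp hker v).mpr hv
  · intro h
    have hker : LinearMap.ker A.mulVecLin = LinearMap.ker (B * A).mulVecLin := le_antisymm hle h
    rw [hker] at hA
    omega

section LowerTriangular

variable {l m n o : Type*} [Fintype m]

theorem rank_fromBlocks_one_zero [DecidableEq m] [Finite o] [Fintype n] (D : Matrix o n K) :
    (fromBlocks (1 : Matrix m m K) 0 0 D).rank = Fintype.card m + D.rank := by
  rw [rank_fromBlocks_zero_zero, rank_one]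

theorem fromBlocks_zero₁₂_eq_mul [DecidableEq m] [Fintype o] [DecidableEq o]
    (A : Matrix l m K) (N : Matrix o m K) (D : Matrix o n K) : fromBlocks A 0 N D =
      fromBlocks A 0 N (1 : Matrix o o K) * fromBlocks (1 : Matrix m m K) 0 0 D := by
  simp [fromBlocks_multiply]

variable [Finite o] [Fintype n] (A : Matrix l m K) (N : Matrix o m K) (D : Matrix o n K)

theorem rank_fromBlocks_zero₁₂_le : (fromBlocks A 0 N D).rank ≤ Fintype.card m + D.rank := by
  classical
  have := Fintype.ofFinite o
  rw [fromBlocks_zero₁₂_eq_mul, ← rank_fromBlocks_one_zero]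
  exact rank_mul_le_right _ _

theorem rank_fromBlocks_zero₁₂_eq_iff :
    (fromBlocks A 0 N D).rank = Fintype.card m + D.rank ↔
      ∀ y z, A *ᵥ y = 0 → N *ᵥ y + D *ᵥ z = 0 → y = 0 := by
  classical
  have := Fintype.ofFinite o
  rw [fromBlocks_zero₁₂_eq_mul, ← rank_fromBlocks_one_zero, rank_mul_eq_right_iff,
    ← fromBlocks_zero₁₂_eq_mul]
  simp only [fromBlocks_mulVec, zero_mulVec, one_mulVec, add_zero, zero_add, sumElim_eq_zero_iff]
  constructor
  · intro h y z hA hND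
    exact (h (Sum.elim y z) ⟨hA, hND⟩).1
  · rintro h v ⟨hA, hND⟩
    have hv := h _ _ hA hND
    exact ⟨hv, by simpa [hv] using hND⟩

end LowerTriangular

theorem exists_mul_mul_eq_one {m : Type*} [Fintype m] (A : Matrix m m K) :
    ∃ (P : Matrix (Fin A.rank) m K) (R : Matrix m (Fin A.rank) K), P * A * R = 1 := by
  classical
  obtain ⟨V, U, e, -, -, h⟩ := A.exists_rank_normal_form
  refine ⟨V.submatrix (e.symm ∘ Sum.inl) id, U.submatrix id (e.symm ∘ Sum.inl), ?_⟩
  calc V.submatrix (e.symm ∘ Sum.inl) id * A * U.submatrix id (e.symm ∘ Sum.inl)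
      = (V * A * U).submatrix (e.symm ∘ Sum.inl) (e.symm ∘ Sum.inl) := rfl
    _ = 1 := by
      rw [h]
      ext i j
      simp [one_apply]

theorem finite_rank_map_eval_lt {m : Type*} [Fintype m] (A : Matrix m m K[X]) (a : K) :
    {x | (A.map (eval x)).rank < (A.map (eval a)).rank}.Finite := by
  classical
  obtain ⟨P, R, hPR⟩ := exists_mul_mul_eq_one (A.map (eval a))
  let p : K[X] := (P.map C * A * R.map C).det
  have hp (x : K) : p.eval x = (P * A.map (eval x) * R).det := by
    have hC : evalRingHom x ∘ C = id := funext fun _ => eval_C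
    rw [← coe_evalRingHom, RingHom.map_det]
    simp only [RingHom.mapMatrix_apply, Matrix.map_mul, Matrix.map_map, hC, Matrix.map_id]
  have hp0 : p ≠ 0 := by
    intro h
    simpa [h, hPR] using hp a
  refine (finite_setOfPred_isRoot hp0).subset fun x hx => ?_
  by_contra hroot
  have hdet : (P * A.map (eval x) * R).det ≠ 0 := hp x ▸ hroot
  have hrank : (A.map (eval a)).rank ≤ (A.map (eval x)).rank := by
    calc (A.map (eval a)).rank = (P * A.map (eval x) * R).rank := by
          rw [rank_of_det_ne_zero hdet, Fintype.card_fin]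
      _ ≤ (P * A.map (eval x)).rank := rank_mul_le_left _ _
      _ ≤ (A.map (eval x)).rank := rank_mul_le_right _ _
  exact hrank.not_gt hx

end Rank

section Quad

/-- The quadratic polynomial `x² a₂ + x a₁ + a₀` in a scalar `x`, for coefficients in a module. -/
def quad {K V : Type*} [Semiring K] [AddCommMonoid V] [Module K V] (a₀ a₁ a₂ : V) (x : K) : V :=
  x ^ 2 • a₂ + x • a₁ + a₀

/-- The derivative `2 x a₂ + a₁` of the quadratic polynomial `quad a₀ a₁ a₂`. -/
def quadDeriv {K V : Type*} [Semiring K] [AddCommMonoid V] [Module K V] (a₁ a₂ : V) (x : K) : V :=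
  (2 * x) • a₂ + a₁

end Quad

section OperatorDeterminant

variable {p q K : Type*}

/-- The `2 × 2` operator determinant: the Leibniz expansion of the determinant with rows `A₁, A₂`
and `B₁, B₂`, with Kronecker products in place of products. -/
def opDet₂ [Ring K] (A₁ A₂ : Matrix p p K) (B₁ B₂ : Matrix q q K) : Matrix (p × q) (p × q) K :=
  A₁ ⊗ₖ B₂ - A₂ ⊗ₖ B₁

theorem opDet₂_mulVec_vec [CommRing K] [Fintype p] [Fintype q] (A₁ A₂ : Matrix p p K)
    (B₁ B₂ : Matrix q q K) (X : Matrix q p K) :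
    opDet₂ A₁ A₂ B₁ B₂ *ᵥ vec X = vec (B₂ * X * A₁ᵀ - B₁ * X * A₂ᵀ) := by
  rw [opDet₂, sub_mulVec, kronecker_mulVec_vec, kronecker_mulVec_vec, vec_sub]

theorem submatrix_opDet₂_fromBlocks [Ring K] (A₁ A₂ : Matrix p p K) (B₁ B₂ D : Matrix q q K) :
    (opDet₂ A₁ A₂ (fromBlocks B₁ 0 D B₁) (fromBlocks B₂ 0 0 B₂)).submatrix
        (Equiv.prodSumDistrib p q q).symm (Equiv.prodSumDistrib p q q).symm =
      fromBlocks (opDet₂ A₁ A₂ B₁ B₂) 0 (opDet₂ A₁ A₂ D 0) (opDet₂ A₁ A₂ B₁ B₂) := by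
  ext (i | i) (j | j) <;> simp [opDet₂]

theorem rank_opDet₂_fromBlocks_le [Field K] [Fintype p] [Fintype q] (A₁ A₂ : Matrix p p K)
    (B₁ B₂ D : Matrix q q K) :
    (opDet₂ A₁ A₂ (fromBlocks B₁ 0 D B₁) (fromBlocks B₂ 0 0 B₂)).rank ≤
      Fintype.card (p × q) + (opDet₂ A₁ A₂ B₁ B₂).rank := by
  rw [← rank_submatrix _ (Equiv.prodSumDistrib p q q).symm (Equiv.prodSumDistrib p q q).symm,
    submatrix_opDet₂_fromBlocks]
  exact rank_fromBlocks_zero₁₂_le _ _ _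

theorem rank_opDet₂_fromBlocks_eq_iff [Field K] [Fintype p] [Fintype q] (A₁ A₂ : Matrix p p K)
    (B₁ B₂ D : Matrix q q K) :
    (opDet₂ A₁ A₂ (fromBlocks B₁ 0 D B₁) (fromBlocks B₂ 0 0 B₂)).rank =
      Fintype.card (p × q) + (opDet₂ A₁ A₂ B₁ B₂).rank ↔
    ∀ Y Z : Matrix q p K, B₂ * Y * A₁ᵀ = B₁ * Y * A₂ᵀ →
      D * Y * A₂ᵀ = B₂ * Z * A₁ᵀ - B₁ * Z * A₂ᵀ → Y = 0 := by
  rw [← rank_submatrix _ (Equiv.prodSumDistrib p q q).symm (Equiv.prodSumDistrib p q q).symm,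
    submatrix_opDet₂_fromBlocks, rank_fromBlocks_zero₁₂_eq_iff]
  simp only [vec_bijective.surjective.forall, opDet₂_mulVec_vec, ← vec_add, vec_eq_zero_iff]
  refine forall₂_congr fun Y Z => ?_
  rw [sub_eq_zero, Matrix.zero_mul, Matrix.zero_mul, zero_sub, neg_add_eq_zero]

theorem det_opDet₂_fromBlocks [CommRing K] [Fintype p] [Fintype q] [DecidableEq p] [DecidableEq q]
    (A₁ A₂ : Matrix p p K) (B₁ B₂ D : Matrix q q K) :
    (opDet₂ A₁ A₂ (fromBlocks B₁ 0 D B₁) (fromBlocks B₂ 0 0 B₂)).det =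
      (opDet₂ A₁ A₂ B₁ B₂).det ^ 2 := by
  rw [← det_submatrix_equiv_self (Equiv.prodSumDistrib p q q).symm, submatrix_opDet₂_fromBlocks,
    det_fromBlocks_zero₁₂, sq]

theorem det_opDet₂_self_of_isSymm [Field K] [Fintype p] [DecidableEq p] [Nonempty p]
    {A B : Matrix p p K} (hA : A.IsSymm) (hB : B.IsSymm) (hBu : IsUnit B.det) :
    (opDet₂ A B A B).det = 0 := by
  refine exists_mulVec_eq_zero_iff.mp ⟨vec B⁻¹, ?_, ?_⟩
  · rw [Ne, vec_eq_zero_iff]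
    intro h
    simpa [h] using mul_nonsing_inv B hBu
  · rw [opDet₂_mulVec_vec, hA.eq, hB.eq, mul_nonsing_inv B hBu, Matrix.one_mul,
      nonsing_inv_mul_cancel_right B A hBu, sub_self, vec_zero]

end OperatorDeterminant

section Linearization

variable {m K : Type*} [Fintype m]

theorem fromBlocks_linearization_eq_mul [CommRing K] [DecidableEq m] (a₀ a₁ a₂ : Matrix m m K)
    (x : K) :
    fromBlocks (-(x • a₁ + a₀)) (-x • a₂) (-x • a₂) a₂ =
      fromBlocks (-1) (-x • (1 : Matrix m m K)) 0 1 * fromBlocks (quad a₀ a₁ a₂ x) 0 0 a₂ *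
        fromBlocks 1 0 (-x • (1 : Matrix m m K)) 1 := by
  simp only [fromBlocks_multiply, Matrix.neg_mul, Matrix.one_mul, Matrix.mul_one,
    Matrix.zero_mul, Matrix.mul_zero, smul_mul_assoc, mul_smul_comm, add_zero, zero_add]
  congr 1
  rw [quad]
  module

theorem rank_linearization [Field K] (a₀ a₁ a₂ : Matrix m m K) (x : K) :
    (fromBlocks (-(x • a₁ + a₀)) (-x • a₂) (-x • a₂) a₂).rank =
      (quad a₀ a₁ a₂ x).rank + a₂.rank := by
  classical
  rw [fromBlocks_linearization_eq_mul, rank_mul_eq_left_of_isUnit_det _ _ (by simp),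
    rank_mul_eq_right_of_isUnit_det _ _ (by simp [det_neg]), rank_fromBlocks_zero_zero]

theorem det_linearization [CommRing K] [DecidableEq m] (a₀ a₁ a₂ : Matrix m m K) (x : K) :
    (fromBlocks (-(x • a₁ + a₀)) (-x • a₂) (-x • a₂) a₂).det =
      (-1) ^ Fintype.card m * (quad a₀ a₁ a₂ x).det * a₂.det := by
  rw [fromBlocks_linearization_eq_mul]
  simp [det_neg, mul_assoc]

end Linearization

section Pencil

variable {p q : Type*}

theorem opDet₂_quad {K : Type*} [CommRing K] (A₀ A₁ A₂ N : Matrix p p K)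
    (B₀ B₁ B₂ N' : Matrix q q K) (x : K) :
    opDet₂ (quad A₀ A₁ A₂ x) N (quad B₀ B₁ B₂ x) N' =
      quad (opDet₂ A₀ N B₀ N') (opDet₂ A₁ N B₁ N') (opDet₂ A₂ N B₂ N') x := by
  simp only [opDet₂, quad, add_kronecker, kronecker_add, smul_kronecker, kronecker_smul]
  module

theorem cx_opDet₂ (A₁ A₂ : Matrix p p ℝ) (B₁ B₂ : Matrix q q ℝ) :
    cx (opDet₂ A₁ A₂ B₁ B₂) = opDet₂ (cx A₁) (cx A₂) (cx B₁) (cx B₂) := by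
  ext
  simp [cx, opDet₂]

/-- The index equivalence that lists the two slices of `p × q × Fin 2` along `Fin 2` one after the
other. -/
def sliceEquiv (p q : Type*) : (p × q) ⊕ (p × q) ≃ p × q × Fin 2 :=
  (Equiv.boolProdEquivSum (p × q)).symm.trans <| (Equiv.prodComm Bool (p × q)).trans <|
    ((Equiv.refl (p × q)).prodCongr finTwoEquiv.symm).trans <| Equiv.prodAssoc p q (Fin 2)

theorem sliceEquiv_inl (i : p × q) : sliceEquiv p q (Sum.inl i) = (i.1, i.2, 0) := rfl

theorem sliceEquiv_inr (i : p × q) : sliceEquiv p q (Sum.inr i) = (i.1, i.2, 1) := rfl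

theorem submatrix_opDet_zero (A₁ A₂ A₃ : Matrix p p ℝ) (B₁ B₂ B₃ : Matrix q q ℝ)
    (D₁ D₂ : Matrix (Fin 2) (Fin 2) ℝ) :
    (opDet A₁ A₂ A₃ B₁ B₂ B₃ D₁ D₂ 0).submatrix (sliceEquiv p q) (sliceEquiv p q) =
      let W i j := D₁ i j • opDet₂ A₂ A₃ B₂ B₃ - D₂ i j • opDet₂ A₁ A₃ B₁ B₃
      fromBlocks (W 0 0) (W 0 1) (W 1 0) (W 1 1) := by
  ext (i | i) (j | j) <;>
    simp only [opDet, opDet₂, submatrix_apply, sliceEquiv_inl, sliceEquiv_inr, Matrix.add_apply,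
      Matrix.sub_apply, Matrix.smul_apply, kroneckerMap_apply, Matrix.zero_apply, smul_eq_mul,
      fromBlocks_apply₁₁, fromBlocks_apply₁₂, fromBlocks_apply₂₁, fromBlocks_apply₂₂] <;>
    ring

/-- The pencil `Δ₁ - x Δ₀` of operator determinants that linearises the two-parameter problem with
rows `x² A₂ + x A₁ + A₀ + μ N` and `x² B₂ + x B₁ + B₀ + μ N'`. -/
noncomputable def opDetPencil (A₀ A₁ A₂ N : Matrix p p ℝ) (B₀ B₁ B₂ N' : Matrix q q ℝ) (x : ℂ) :
    Matrix (p × q × Fin 2) (p × q × Fin 2) ℂ :=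
  cx (-opDet A₂ A₀ N B₂ B₀ N' C₂ C₀ 0) - x • cx (opDet A₂ A₁ N B₂ B₁ N' C₂ C₁ 0)

variable (A₀ A₁ A₂ N : Matrix p p ℝ) (B₀ B₁ B₂ N' : Matrix q q ℝ) (x : ℂ)

theorem submatrix_opDetPencil :
    (opDetPencil A₀ A₁ A₂ N B₀ B₁ B₂ N' x).submatrix (sliceEquiv p q) (sliceEquiv p q) =
      fromBlocks (-(x • cx (opDet₂ A₁ N B₁ N') + cx (opDet₂ A₀ N B₀ N')))
        (-x • cx (opDet₂ A₂ N B₂ N')) (-x • cx (opDet₂ A₂ N B₂ N')) (cx (opDet₂ A₂ N B₂ N')) := by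
  have hslice (A B : Matrix (p × q × Fin 2) (p × q × Fin 2) ℝ) :
      (cx (-A) - x • cx B).submatrix (sliceEquiv p q) (sliceEquiv p q) =
        cx (-A.submatrix (sliceEquiv p q) (sliceEquiv p q)) -
          x • cx (B.submatrix (sliceEquiv p q) (sliceEquiv p q)) := rfl
  rw [opDetPencil, hslice, submatrix_opDet_zero, submatrix_opDet_zero]
  ext (i | i) (j | j) <;> simp [cx, C₀, C₁, C₂, sub_eq_add_neg]

theorem rank_opDetPencil [Fintype p] [Fintype q] :
    (opDetPencil A₀ A₁ A₂ N B₀ B₁ B₂ N' x).rank =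
      (opDet₂ (quad (cx A₀) (cx A₁) (cx A₂) x) (cx N)
        (quad (cx B₀) (cx B₁) (cx B₂) x) (cx N')).rank +
      (opDet₂ (cx A₂) (cx N) (cx B₂) (cx N')).rank := by
  classical
  simp only [opDet₂_quad, ← cx_opDet₂]
  rw [← rank_linearization, ← submatrix_opDetPencil, rank_submatrix]

theorem det_opDetPencil [Fintype p] [Fintype q] [DecidableEq p] [DecidableEq q] :
    (opDetPencil A₀ A₁ A₂ N B₀ B₁ B₂ N' x).det =
      (-1) ^ Fintype.card (p × q) *
      (opDet₂ (quad (cx A₀) (cx A₁) (cx A₂) x) (cx N)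
        (quad (cx B₀) (cx B₁) (cx B₂) x) (cx N')).det *
      (opDet₂ (cx A₂) (cx N) (cx B₂) (cx N')).det := by
  simp only [opDet₂_quad, ← cx_opDet₂]
  rw [← det_linearization, ← submatrix_opDetPencil, det_submatrix_equiv_self]

end Pencil

section ImaginaryAxis

theorem eventually_eq_zero_of_norm_quad_mul_le {𝕜 R : Type*} [NormedField 𝕜] [NormedRing R]
    [NormedAlgebra 𝕜 R] (a₀ a₁ b₀ b₁ : R) {a₂ : R} (ha₂ : IsUnit a₂) :
    ∀ᶠ x : 𝕜 in Bornology.cobounded 𝕜,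
      ∀ y, ‖quad a₀ a₁ a₂ x * y‖ ≤ ‖(x • b₁ + b₀) * y‖ → y = 0 := by
  obtain ⟨u, rfl⟩ := ha₂
  -- After division by `x ^ 2`, every term but `a₂ * y` carries a factor `t = x⁻¹ → 0`.
  let κ (t : 𝕜) : ℝ := ‖(↑u⁻¹ : R)‖ * (‖t • b₁ + t ^ 2 • b₀‖ + ‖t • a₁ + t ^ 2 • a₀‖)
  have hκ : ∀ᶠ t in 𝓝 (0 : 𝕜), κ t < 1 := by
    have hcont : Continuous κ := by fun_prop
    refine hcont.continuousAt.eventually_lt continuousAt_const ?_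
    simp [κ]
  filter_upwards [tendsto_inv₀_cobounded.eventually hκ, Bornology.eventually_ne_cobounded 0]
    with x hx hx0 y hy
  have hrescale : ↑u * y =
      x⁻¹ ^ 2 • (quad a₀ a₁ ↑u x * y) - (x⁻¹ • a₁ + x⁻¹ ^ 2 • a₀) * y := by
    rw [← smul_mul_assoc, ← sub_mul]
    congr 1
    simp [quad, smul_smul, sq, hx0, mul_assoc]
  have hbound : ‖↑u * y‖ ≤
      (‖x⁻¹ • b₁ + x⁻¹ ^ 2 • b₀‖ + ‖x⁻¹ • a₁ + x⁻¹ ^ 2 • a₀‖) * ‖y‖ := by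
    have hb : x⁻¹ • b₁ + x⁻¹ ^ 2 • b₀ = x⁻¹ ^ 2 • (x • b₁ + b₀) := by
      simp [smul_smul, sq, hx0]
    calc ‖↑u * y‖ ≤ ‖x⁻¹ ^ 2 • (quad a₀ a₁ ↑u x * y)‖ + ‖(x⁻¹ • a₁ + x⁻¹ ^ 2 • a₀) * y‖ :=
          hrescale ▸ norm_sub_le _ _
      _ ≤ ‖(x⁻¹ • b₁ + x⁻¹ ^ 2 • b₀) * y‖ + ‖(x⁻¹ • a₁ + x⁻¹ ^ 2 • a₀) * y‖ := by
          rw [hb, smul_mul_assoc, norm_smul, norm_smul]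
          gcongr
      _ ≤ ‖x⁻¹ • b₁ + x⁻¹ ^ 2 • b₀‖ * ‖y‖ + ‖x⁻¹ • a₁ + x⁻¹ ^ 2 • a₀‖ * ‖y‖ :=
          add_le_add (norm_mul_le _ _) (norm_mul_le _ _)
      _ = (‖x⁻¹ • b₁ + x⁻¹ ^ 2 • b₀‖ + ‖x⁻¹ • a₁ + x⁻¹ ^ 2 • a₀‖) * ‖y‖ := (add_mul _ _ _).symm
  have hle : ‖y‖ ≤ κ x⁻¹ * ‖y‖ := by
    calc ‖y‖ = ‖↑u⁻¹ * (↑u * y)‖ := by rw [Units.inv_mul_cancel_left]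
      _ ≤ ‖(↑u⁻¹ : R)‖ * ‖↑u * y‖ := norm_mul_le _ _
      _ ≤ κ x⁻¹ * ‖y‖ := by
          rw [mul_assoc]
          gcongr
  by_contra hy0
  nlinarith [norm_pos_iff.mpr hy0]

variable {m 𝕜 : Type*} [RCLike 𝕜]

theorem isHermitian_quad {G₀ G₁ G₂ : Matrix m m 𝕜} (h₀ : G₀.IsHermitian) (h₁ : G₁ᴴ = -G₁)
    (h₂ : G₂.IsHermitian) {x : 𝕜} (hx : star x = -x) : (quad G₀ G₁ G₂ x).IsHermitian := by
  simp [IsHermitian, quad, conjTranspose_smul, h₀.eq, h₁, h₂.eq, hx]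

variable [Fintype m]

theorem trace_conjTranspose_mul_commutator {H W : Matrix m m 𝕜} (hH : H.IsHermitian)
    (hW : H * W = W * Hᵀ) (Z : Matrix m m 𝕜) : (Wᴴ * (Z * Hᵀ - H * Z)).trace = 0 := by
  have hWH : Wᴴ * H = Hᵀ * Wᴴ := by
    simpa [hH.eq, hH.transpose.eq] using congrArg conjTranspose hW
  rw [mul_sub, trace_sub, ← Matrix.mul_assoc, trace_mul_comm, ← Matrix.mul_assoc,
    ← Matrix.mul_assoc, ← hWH, sub_self]

attribute [local instance] Matrix.frobeniusNormedRing Matrix.frobeniusNormedAlgebra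

variable [DecidableEq m]

theorem re_trace_conjTranspose_mul_self (A : Matrix m m 𝕜) :
    RCLike.re (Aᴴ * A).trace = ‖A‖ ^ 2 := by
  rw [frobenius_norm_def, ← Real.sqrt_eq_rpow, Real.sq_sqrt (by positivity), Finset.sum_comm]
  simp [trace, mul_apply, RCLike.conj_mul, -map_pow, ← RCLike.ofReal_pow]

theorem norm_le_norm_add_of_trace_eq_zero {A B : Matrix m m 𝕜} (h : (Aᴴ * B).trace = 0) :
    ‖A‖ ≤ ‖A + B‖ := by
  have h' : (Bᴴ * A).trace = 0 := by
    rw [← conjTranspose_conjTranspose A, ← conjTranspose_mul, trace_conjTranspose, h, star_zero]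
  have hpyth : ‖A + B‖ ^ 2 = ‖A‖ ^ 2 + ‖B‖ ^ 2 := by
    simp only [← re_trace_conjTranspose_mul_self, conjTranspose_add, add_mul, mul_add, trace_add,
      h, h', map_add, map_zero]
    ring
  exact le_of_sq_le_sq (by nlinarith [sq_nonneg ‖B‖]) (norm_nonneg _)

theorem eventually_eq_zero_of_commutator {G₀ G₁ G₂ : Matrix m m 𝕜} (h₀ : G₀.IsHermitian)
    (h₁ : G₁ᴴ = -G₁) (h₂ : G₂.IsHermitian) (hG₂ : IsUnit G₂) :
    ∀ᶠ x in Bornology.cobounded 𝕜, star x = -x → ∀ Y Z,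
      Y * (quad G₀ G₁ G₂ x)ᵀ = quad G₀ G₁ G₂ x * Y →
      quadDeriv G₁ G₂ x * Y = Z * (quad G₀ G₁ G₂ x)ᵀ - quad G₀ G₁ G₂ x * Z → Y = 0 := by
  filter_upwards [eventually_eq_zero_of_norm_quad_mul_le G₀ G₁ G₀ ((1 / 2 : 𝕜) • G₁) hG₂]
    with x hsmall hx Y Z hY hZ
  apply hsmall
  -- `H Y - (x / 2) H' Y` has no term in `x ^ 2`, and its two summands are Frobenius-orthogonal.
  set H := quad G₀ G₁ G₂ x with hHdef
  have hH : H.IsHermitian := isHermitian_quad h₀ h₁ h₂ hx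
  have hsplit : (x • (1 / 2 : 𝕜) • G₁ + G₀) * Y = H * Y + (-x / 2) • (quadDeriv G₁ G₂ x * Y) := by
    rw [hHdef, quad, quadDeriv, ← smul_mul_assoc, ← add_mul]
    congr 1
    module
  rw [hsplit]
  apply norm_le_norm_add_of_trace_eq_zero
  rw [hZ, mul_smul_comm, trace_smul, trace_conjTranspose_mul_commutator hH, smul_zero]
  rw [Matrix.mul_assoc, hY]

end ImaginaryAxis

section Congruence

variable {m : Type*} [Fintype m]

theorem mul_quad_mul {K : Type*} [CommRing K] (R G₀ G₁ G₂ P : Matrix m m K) (x : K) :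
    R * quad G₀ G₁ G₂ x * P = quad (R * G₀ * P) (R * G₁ * P) (R * G₂ * P) x := by
  simp [quad, mul_add, add_mul]

theorem mul_quadDeriv_mul {K : Type*} [CommRing K] (R G₁ G₂ P : Matrix m m K) (x : K) :
    R * quadDeriv G₁ G₂ x * P = quadDeriv (R * G₁ * P) (R * G₂ * P) x := by
  simp [quadDeriv, mul_add, add_mul]

theorem mul_mul_mul_transpose_congr {K : Type*} [CommRing K] [DecidableEq m] {B P : Matrix m m K}
    (hPB : P * B = 1) (R A C Y : Matrix m m K) :
    R * A * P * (B * Y * Bᵀ) * (R * C * P)ᵀ = R * (A * Y * Cᵀ) * Rᵀ := by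
  have hPB' : Bᵀ * Pᵀ = 1 := by rw [← transpose_mul, hPB, transpose_one]
  calc R * A * P * (B * Y * Bᵀ) * (R * C * P)ᵀ
      = R * A * (P * B) * Y * (Bᵀ * Pᵀ) * Cᵀ * Rᵀ := by
        simp only [transpose_mul, Matrix.mul_assoc]
    _ = R * (A * Y * Cᵀ) * Rᵀ := by
        simp only [hPB, hPB', Matrix.mul_one, Matrix.mul_assoc]

open scoped ComplexOrder

open scoped MatrixOrder in
theorem exists_conjTranspose_mul_mul_eq_one {𝕜 : Type*} [RCLike 𝕜] [DecidableEq m]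
    {M : Matrix m m 𝕜} (hM : M.PosDef) :
    ∃ P B : Matrix m m 𝕜, P * B = 1 ∧ Pᴴ * M * P = 1 := by
  obtain ⟨B, ⟨u, rfl⟩, rfl⟩ :=
    CStarAlgebra.isStrictlyPositive_iff_eq_star_mul_self.mp hM.isStrictlyPositive
  refine ⟨↑u⁻¹, ↑u, u.inv_mul, ?_⟩
  rw [← star_eq_conjTranspose, ← mul_assoc, ← star_mul, u.mul_inv, star_one, one_mul, u.mul_inv]

theorem eventually_eq_zero_of_commutator_posDef {𝕜 : Type*} [RCLike 𝕜] [DecidableEq m]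
    {G₀ G₁ G₂ M : Matrix m m 𝕜} (h₀ : G₀.IsHermitian) (h₁ : G₁ᴴ = -G₁) (h₂ : G₂.IsHermitian)
    (hG₂ : IsUnit G₂) (hM : M.PosDef) :
    ∀ᶠ x in Bornology.cobounded 𝕜, star x = -x → ∀ Y Z,
      M * Y * (quad G₀ G₁ G₂ x)ᵀ = quad G₀ G₁ G₂ x * Y * Mᵀ →
      quadDeriv G₁ G₂ x * Y * Mᵀ =
        M * Z * (quad G₀ G₁ G₂ x)ᵀ - quad G₀ G₁ G₂ x * Z * Mᵀ → Y = 0 := by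
  obtain ⟨P, B, hPB, hP⟩ := exists_conjTranspose_mul_mul_eq_one hM
  have hPu : IsUnit P := IsUnit.of_mul_eq_one _ hPB
  filter_upwards [eventually_eq_zero_of_commutator (isHermitian_conjTranspose_mul_mul P h₀)
    (G₁ := Pᴴ * G₁ * P) (by simp [h₁, Matrix.mul_assoc]) (isHermitian_conjTranspose_mul_mul P h₂)
    (((isUnit_conjTranspose P).mpr hPu).mul hG₂ |>.mul hPu)] with x hx hxs Y Z hY hZ
  have hcongr := mul_mul_mul_transpose_congr hPB Pᴴ
  set Q := quad G₀ G₁ G₂ x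
  have hzero : B * Y * Bᵀ = 0 := by
    apply hx hxs _ (B * Z * Bᵀ)
    · rw [← mul_quad_mul]
      have := congrArg (fun X => Pᴴ * X * Pᴴᵀ) hY
      simpa only [← hcongr, hP, Matrix.one_mul, Matrix.mul_one, transpose_one] using this
    · rw [← mul_quad_mul, ← mul_quadDeriv_mul]
      have := congrArg (fun X => Pᴴ * X * Pᴴᵀ) hZ
      simpa only [Matrix.mul_sub, Matrix.sub_mul, ← hcongr, hP, Matrix.one_mul, Matrix.mul_one,
        transpose_one] using this
  calc Y = P * B * Y * (P * B)ᵀ := by simp [hPB]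
    _ = P * (B * Y * Bᵀ) * Pᵀ := by simp only [transpose_mul, Matrix.mul_assoc]
    _ = 0 := by simp [hzero]

end Congruence

section RankDrop

/-- The operator determinant of the rows `Q + μ N` and `[Q, 0; D, Q] + μ [N, 0; 0, N]` of a
two-parameter problem. The ZGV problem has `Q = L(x)` and `D = L'(x)` for a quadratic `L`. -/
def zgvOpDet {m K : Type*} [Ring K] (Q D N : Matrix m m K) :
    Matrix (m × (m ⊕ m)) (m × (m ⊕ m)) K :=
  opDet₂ Q N (fromBlocks Q 0 D Q) (fromBlocks N 0 0 N)

theorem rank_zgvOpDet_lt {K m : Type*} [Field K] [Fintype m] {Q D N : Matrix m m K} {μ : K}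
    {u u' : m → K} (hu : u ≠ 0) (hQ : Q *ᵥ u + μ • (N *ᵥ u) = 0)
    (hD : D *ᵥ u + Q *ᵥ u' + μ • (N *ᵥ u') = 0) :
    (zgvOpDet Q D N).rank < Fintype.card (m × m) + (opDet₂ Q N Q N).rank := by
  refine (rank_opDet₂_fromBlocks_le Q N Q N D).lt_of_ne fun heq => ?_
  rw [add_eq_zero_iff_eq_neg] at hQ
  rw [add_assoc, add_eq_zero_iff_eq_neg] at hD
  refine vecMulVec_ne_zero hu hu <|
    (rank_opDet₂_fromBlocks_eq_iff Q N Q N D).mp heq (vecMulVec u u) (vecMulVec u' u) ?_ ?_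
  · simp only [mul_vecMulVec, vecMulVec_mul, vecMul_transpose]
    simp only [hQ, vecMulVec_neg, vecMulVec_smul, neg_vecMulVec, smul_vecMulVec]
  · simp only [mul_vecMulVec, vecMulVec_mul, vecMul_transpose]
    simp only [hQ, hD, vecMulVec_neg, vecMulVec_smul, neg_vecMulVec, add_vecMulVec, smul_vecMulVec]
    module

theorem finite_rank_quad_lt {K m : Type*} [Field K] [Fintype m] (a₀ a₁ a₂ : Matrix m m K)
    (x₀ : K) : {x : K | (quad a₀ a₁ a₂ x).rank < (quad a₀ a₁ a₂ x₀).rank}.Finite := by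
  have heval (x : K) :
      (quad (a₀.map C) (a₁.map C) (a₂.map C) (X : K[X])).map (eval x) = quad a₀ a₁ a₂ x := by
    ext
    simp [quad]
    ring
  simpa only [heval] using
    finite_rank_map_eval_lt (quad (a₀.map C) (a₁.map C) (a₂.map C) (X : K[X])) x₀

theorem frequently_star_eq_neg_cobounded : ∃ᶠ x in Bornology.cobounded ℂ, star x = -x := by
  have htendsto : Tendsto (fun r : ℝ => (r : ℂ) * Complex.I) atTop (Bornology.cobounded ℂ) := by
    rw [← tendsto_norm_atTop_iff_cobounded]
    simpa using tendsto_abs_atTop_atTop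
  exact htendsto.frequently (Frequently.of_forall fun r => by simp)

open scoped ComplexOrder in
theorem exists_le_rank_zgvOpDet_quad {m : Type*} [Fintype m] [DecidableEq m]
    {G₀ G₁ G₂ M : Matrix m m ℂ} (h₀ : G₀.IsHermitian) (h₁ : G₁ᴴ = -G₁) (h₂ : G₂.IsHermitian)
    (hG₂ : IsUnit G₂) (hM : M.PosDef) (x₀ : ℂ) :
    ∃ x : ℂ, Fintype.card (m × m) +
        (opDet₂ (quad G₀ G₁ G₂ x₀) M (quad G₀ G₁ G₂ x₀) M).rank ≤
      (zgvOpDet (quad G₀ G₁ G₂ x) (quadDeriv G₁ G₂ x) M).rank := by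
  have hgeneric : ∀ᶠ x in Bornology.cobounded ℂ,
      (opDet₂ (quad G₀ G₁ G₂ x₀) M (quad G₀ G₁ G₂ x₀) M).rank ≤
        (opDet₂ (quad G₀ G₁ G₂ x) M (quad G₀ G₁ G₂ x) M).rank := by
    simp only [opDet₂_quad, ← not_lt]
    exact Bornology.le_cofinite ℂ (finite_rank_quad_lt _ _ _ x₀).compl_mem_cofinite
  obtain ⟨x, hstar, hinj, hle⟩ := (frequently_star_eq_neg_cobounded.and_eventually
    ((eventually_eq_zero_of_commutator_posDef h₀ h₁ h₂ hG₂ hM).and hgeneric)).exists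
  refine ⟨x, ?_⟩
  rw [zgvOpDet, (rank_opDet₂_fromBlocks_eq_iff _ _ _ _ _).mpr (hinj hstar)]
  gcongr

end RankDrop

section Complexification

variable {m : Type*}

theorem cx_zero : cx (0 : Matrix m m ℝ) = 0 := Matrix.map_zero _ Complex.ofReal_zero

theorem cx_neg (A : Matrix m m ℝ) : cx (-A) = -cx A := Matrix.map_neg _ Complex.ofReal_neg A

theorem cx_fromBlocks (A B C D : Matrix m m ℝ) :
    cx (fromBlocks A B C D) = fromBlocks (cx A) (cx B) (cx C) (cx D) :=
  fromBlocks_map _ _ _ _ _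

theorem conjTranspose_cx (A : Matrix m m ℝ) : (cx A)ᴴ = cx Aᵀ := by
  ext
  simp [cx]

theorem isSymm_cx {A : Matrix m m ℝ} (hA : A.IsSymm) : (cx A).IsSymm := hA.map _

theorem isHermitian_cx {A : Matrix m m ℝ} (hA : A.IsSymm) : (cx A).IsHermitian := by
  rw [IsHermitian, conjTranspose_cx, hA.eq]

theorem isUnit_cx [Fintype m] [DecidableEq m] {A : Matrix m m ℝ} (hA : IsUnit A) : IsUnit (cx A) :=
  hA.map Complex.ofRealHom.mapMatrix

open scoped ComplexOrder MatrixOrder in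
theorem posDef_cx [Finite m] {A : Matrix m m ℝ} (hA : A.PosDef) : (cx A).PosDef := by
  classical
  have := Fintype.ofFinite m
  obtain ⟨B, hB, rfl⟩ :=
    CStarAlgebra.isStrictlyPositive_iff_eq_star_mul_self.mp hA.isStrictlyPositive
  have hmul : cx (star B * B) = (cx B)ᴴ * cx B := by
    rw [conjTranspose_cx]
    exact Complex.ofRealHom.mapMatrix.map_mul _ _
  rw [hmul]
  exact PosDef.conjTranspose_mul_self _ (mulVec_injective_of_isUnit (isUnit_cx hB))

end Complexification

section Waveguide

variable {n : ℕ} {L₀ L₁ L₂ M : Matrix (Fin n) (Fin n) ℝ}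

theorem quad_tilde (L₀ L₁ L₂ : Matrix (Fin n) (Fin n) ℝ) (x : ℂ) :
    quad (cx (tildeL₀ L₀ L₁)) (cx (tildeL₁ L₁ L₂)) (cx (tildeL₂ L₂)) x =
      fromBlocks (quad (cx L₀) (cx L₁) (cx L₂) x) 0 (quadDeriv (cx L₁) (cx L₂) x)
        (quad (cx L₀) (cx L₁) (cx L₂) x) := by
  ext (i | i) (j | j) <;> simp [quad, quadDeriv, tildeL₀, tildeL₁, tildeL₂, cx]
  ring

theorem cx_tildeM (M : Matrix (Fin n) (Fin n) ℝ) :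
    cx (tildeM M) = fromBlocks (cx M) 0 0 (cx M) := by
  rw [tildeM, cx_fromBlocks, cx_zero]

theorem rank_pencil (L₀ L₁ L₂ M : Matrix (Fin n) (Fin n) ℝ) (x : ℂ) :
    (cx (Δ₁ L₀ L₁ L₂ M) - x • cx (Δ₀ L₁ L₂ M)).rank =
      (zgvOpDet (quad (cx L₀) (cx L₁) (cx L₂) x) (quadDeriv (cx L₁) (cx L₂) x) (cx M)).rank +
      (opDet₂ (cx L₂) (cx M) (cx (tildeL₂ L₂)) (cx (tildeM M))).rank := by
  rw [zgvOpDet, ← quad_tilde, ← cx_tildeM]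
  exact rank_opDetPencil ..

theorem isSingularPencil [NeZero n] (L₀ L₁ : Matrix (Fin n) (Fin n) ℝ) (hL₂ : L₂.IsSymm)
    (hM : M.IsSymm) (hMu : IsUnit M) :
    IsSingularPencil (cx (Δ₁ L₀ L₁ L₂ M)) (cx (Δ₀ L₁ L₂ M)) := by
  intro x
  have hconst : (opDet₂ (cx L₂) (cx M) (cx (tildeL₂ L₂)) (cx (tildeM M))).det = 0 := by
    rw [cx_tildeM, tildeL₂, cx_fromBlocks, cx_zero, det_opDet₂_fromBlocks,
      det_opDet₂_self_of_isSymm (isSymm_cx hL₂) (isSymm_cx hM)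
        ((isUnit_iff_isUnit_det _).mp (isUnit_cx hMu)), zero_pow two_ne_zero]
  calc (cx (Δ₁ L₀ L₁ L₂ M) - x • cx (Δ₀ L₁ L₂ M)).det = _ := det_opDetPencil ..
    _ = 0 := by rw [hconst, mul_zero]

variable {k ω : ℂ}

theorem IsZGVSolution.exists_mulVec_eq (h : IsZGVSolution L₀ L₁ L₂ M k ω) :
    ∃ u u' : Fin n → ℂ, u ≠ 0 ∧
      quad (cx L₀) (cx L₁) (cx L₂) (Complex.I * k) *ᵥ u + ω ^ 2 • (cx M *ᵥ u) = 0 ∧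
      quadDeriv (cx L₁) (cx L₂) (Complex.I * k) *ᵥ u +
        quad (cx L₀) (cx L₁) (cx L₂) (Complex.I * k) *ᵥ u' + ω ^ 2 • (cx M *ᵥ u') = 0 := by
  obtain ⟨u, u', hu, hW, hE⟩ := h
  refine ⟨u, u', hu, ?_, ?_⟩
  · rw [← smul_mulVec, ← add_mulVec]
    exact hW
  · have hexc : exceptionalOp L₀ L₁ L₂ M k ω =
        quad (cx (tildeL₀ L₀ L₁)) (cx (tildeL₁ L₁ L₂)) (cx (tildeL₂ L₂)) (Complex.I * k) +
          ω ^ 2 • cx (tildeM M) := rfl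
    rw [hexc, quad_tilde, cx_tildeM, add_mulVec, smul_mulVec, fromBlocks_mulVec,
      fromBlocks_mulVec] at hE
    simpa [funext_iff] using congrArg (· ∘ Sum.inr) hE

theorem IsZGVSolution.neZero (h : IsZGVSolution L₀ L₁ L₂ M k ω) : NeZero n := by
  obtain ⟨u, -, hu, -⟩ := h
  obtain ⟨i, -⟩ := Function.ne_iff.mp hu
  exact ⟨i.pos.ne'⟩

theorem IsZGVSolution.isFiniteEigenvalue (h : IsZGVSolution L₀ L₁ L₂ M k ω) (hL₀ : L₀.IsSymm)
    (hL₁ : L₁ᵀ = -L₁) (hL₂ : L₂.IsSymm) (hL₂u : IsUnit L₂) (hM : M.PosDef) :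
    IsFiniteEigenvalue (cx (Δ₁ L₀ L₁ L₂ M)) (cx (Δ₀ L₁ L₂ M)) (Complex.I * k) := by
  obtain ⟨u, u', hu, hQ, hD⟩ := h.exists_mulVec_eq
  have hskew : (cx L₁)ᴴ = -cx L₁ := by rw [conjTranspose_cx, hL₁, cx_neg]
  obtain ⟨x, hx⟩ := exists_le_rank_zgvOpDet_quad (isHermitian_cx hL₀) hskew (isHermitian_cx hL₂)
    (isUnit_cx hL₂u) (posDef_cx hM) (Complex.I * k)
  refine lt_of_lt_of_le ?_ ((isGreatest_normalRank _ _).2 ⟨x, rfl⟩)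
  simp only [rank_pencil]
  gcongr
  exact (rank_zgvOpDet_lt hu hQ hD).trans_le hx

end Waveguide

end ZGV

theorem theorem1 (n : ℕ) (L₀ L₁ L₂ M : Matrix (Fin n) (Fin n) ℝ)
    (hL₀ : L₀.transpose = L₀) (hL₁ : L₁.transpose = -L₁) (hL₂ : L₂.transpose = L₂)
    (hM : M.PosDef) (hL₂reg : IsUnit L₂.det)
    (k ω : ℂ) (hsol : ZGV.IsZGVSolution L₀ L₁ L₂ M k ω) :
    ZGV.IsSingularPencil (ZGV.cx (ZGV.Δ₁ L₀ L₁ L₂ M)) (ZGV.cx (ZGV.Δ₀ L₁ L₂ M)) ∧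
      ZGV.IsFiniteEigenvalue (ZGV.cx (ZGV.Δ₁ L₀ L₁ L₂ M)) (ZGV.cx (ZGV.Δ₀ L₁ L₂ M))
        (Complex.I * k) := by
  have hMsymm : M.IsSymm := by simpa [Matrix.IsSymm] using hM.isHermitian.eq
  have hL₂u : IsUnit L₂ := (Matrix.isUnit_iff_isUnit_det L₂).mpr hL₂reg
  have := hsol.neZero
  exact ⟨ZGV.isSingularPencil L₀ L₁ hL₂ hMsymm hM.isUnit,
    hsol.isFiniteEigenvalue hL₀ hL₁ hL₂ hL₂u hM⟩
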